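/- Let $K$ be a field of characteristic different from $2$ and $3$. An \emph{$\omega$-Lie algebra} is an anticommutative $K$-algebra $L$ with product $[\cdot,\cdot]$ together with a bilinear form $\omega:L\times L\to K$ such that $$[[x,y],z]+[[z,x],y]+[[y,z],x]=\omega(x,y)z+\omega(z,x)y+\omega(y,z)x\qquad\text{for all }x,y,z\in L.$$ Write $\operatorname{Ker}\omega=\{x\in L:\omega(x,L)=0\}$ and $\operatorname{ad}x:y\mapsto[y,x]$. A Lie algebra is called \emph{almost abelian} with \emph{abelian part} $A$ if it is a semidirect sum $A\oplus Kx$ with $A$ abelian and $\operatorname{ad}x$ acting on $A$ as the identity. Let $L$ be a finite-dimensional $\omega$-Lie algebra over $K$ which is not a Lie algebra. Then at least one of the following holds: (i) $\dim L=3$. (ii) $L$ has a Lie subalgebra $M$ of codimension $1$ such that, for every $v\in L\setminus M$, with $\alpha:M\to K$, $\alpha(x)=\omega(x,v)$, the kernel $\operatorname{Ker}\alpha$ is a subalgebra of codimension $1$ in $M$ and one of the following holds: (a) $M=A\oplus Kx$, $A$ is abelian, $\operatorname{ad}x$ maps $A$ to $A$ (by an arbitrary linear map); $\operatorname{Ker}\alpha=A$;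 (b) $M$ is the direct sum of an abelian Lie algebra $A$ and the two-dimensional Lie algebra $\langle x,y\mid[x,y]=y\rangle$; $\operatorname{Ker}\alpha=A\oplus Kx$; (c) $M=A\oplus Kx\oplus Ky$, $A$ is abelian, $\operatorname{ad}x$ is the identity on $A$, $\operatorname{ad}y$ maps $A$ to $A$ (by an arbitrary linear map), and $[x,y]\in A$; $\operatorname{Ker}\alpha=A\oplus Kx$; (d) $M=A\oplus Kx\oplus Ky$, $A$ is abelian, $\operatorname{ad}x$ is the identity on $A$, $\operatorname{ad}y$ is zero on $A$, and $[x,y]=a+\sigma y$ for some $a\in A$ and $0\neq\sigma\in K$; $\operatorname{Ker}\alpha=A\oplus Kx$. (iii) $\operatorname{Ker}\omega$ is a subalgebra of codimension $2$ in $L$ which is an almost abelian Lie algebra, and for every element $a$ of its abelian part the endomorphism $\operatorname{ad}a$ of $L$ is nilpotent. In all the cases, $L$ has an abelian subalgebra of codimension at most $3$. -/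

import Mathlib

/-! An algebra structure on a vector space `L` is a bilinear map `br : L →ₗ[K] L →ₗ[K] L`,
with `br x y` in the role of `[x, y]`. -/

namespace OmegaLie

variable {K L : Type*} [Field K] [AddCommGroup L] [Module K L]

/-- The algebra `(L, br)` is an `ω`-Lie algebra: it is anticommutative and satisfies the
`ω`-Jacobi identity. (Skew-symmetry of `ω` is not required, it is a consequence in
dimension at least `2`.) -/
structure IsOmegaLieAlgebra (br : L →ₗ[K] L →ₗ[K] L) (ω : L →ₗ[K] L →ₗ[K] K) : Prop where
  bracket_self : ∀ x : L, br x x = 0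
  omega_jacobi : ∀ x y z : L,
    br (br x y) z + br (br z x) y + br (br y z) x = ω x y • z + ω z x • y + ω y z • x

/-- The subspace `S` is a subalgebra. -/
def IsSubalgebra (br : L →ₗ[K] L →ₗ[K] L) (S : Submodule K L) : Prop :=
  ∀ x ∈ S, ∀ y ∈ S, br x y ∈ S

/-- The subspace `S` is an abelian subalgebra: all products of its elements vanish. -/
def IsAbelian (br : L →ₗ[K] L →ₗ[K] L) (S : Submodule K L) : Prop :=
  ∀ x ∈ S, ∀ y ∈ S, br x y = 0

/-- The subspace `S` is a subalgebra which is a Lie algebra under the restricted product. -/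
structure IsLieSubalgebra (br : L →ₗ[K] L →ₗ[K] L) (S : Submodule K L) : Prop where
  isSubalgebra : IsSubalgebra br S
  bracket_self : ∀ x ∈ S, br x x = 0
  jacobi : ∀ x ∈ S, ∀ y ∈ S, ∀ z ∈ S,
    br (br x y) z + br (br z x) y + br (br y z) x = 0

/-- The whole algebra `(L, br)` is a Lie algebra. -/
def IsLieAlgebra (br : L →ₗ[K] L →ₗ[K] L) : Prop :=
  IsLieSubalgebra br ⊤

/-- The adjoint endomorphism `ad x : y ↦ [y, x]`, a right multiplication. -/
def ad (br : L →ₗ[K] L →ₗ[K] L) (x : L) : Module.End K L :=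
  br.flip x

/-- The subspace `S` is an almost abelian Lie algebra with abelian part `A`: it is the
semidirect sum `A ⊕ Kx` with `A` abelian and `ad x` acting on `A` as the identity. -/
def IsAlmostAbelianWithPart (br : L →ₗ[K] L →ₗ[K] L) (S A : Submodule K L) : Prop :=
  IsLieSubalgebra br S ∧ IsAbelian br A ∧
    ∃ x : L, x ∉ A ∧ S = A ⊔ Submodule.span K {x} ∧ ∀ a ∈ A, ad br x a = a

/-- For a subspace `M` and a vector `v`, the kernel of the linear form
`α : M → K`, `α x = ω x v`. -/
def alphaKer (ω : L →ₗ[K] L →ₗ[K] K) (M : Submodule K L) (v : L) : Submodule K L :=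
  M ⊓ LinearMap.ker (ω.flip v)

/-- `M = A ⊕ Kx`, `A` is abelian, `ad x : A → A` is any linear map; `Ker α = A`. -/
def TypeA (br : L →ₗ[K] L →ₗ[K] L) (M kerα : Submodule K L) : Prop :=
  ∃ (A : Submodule K L) (x : L),
    x ∉ A ∧ M = A ⊔ Submodule.span K {x} ∧
    IsAbelian br A ∧ (∀ a ∈ A, ad br x a ∈ A) ∧
    kerα = A

/-- `M` is the direct sum of an abelian Lie algebra `A` and the two-dimensional nonabelian
Lie algebra `⟨x, y | [x, y] = y⟩`; `Ker α = A ⊕ Kx`. -/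
def TypeB (br : L →ₗ[K] L →ₗ[K] L) (M kerα : Submodule K L) : Prop :=
  ∃ (A : Submodule K L) (x y : L),
    x ∉ A ∧ y ∉ A ⊔ Submodule.span K {x} ∧
    M = A ⊔ Submodule.span K {x} ⊔ Submodule.span K {y} ∧
    IsAbelian br A ∧ (∀ a ∈ A, ad br x a = 0) ∧ (∀ a ∈ A, ad br y a = 0) ∧
    br x y = y ∧
    kerα = A ⊔ Submodule.span K {x}

/-- `M = A ⊕ Kx ⊕ Ky`, `A` is abelian, `ad x : A → A` is the identity, `ad y : A → A` is any
linear map, and `[x, y] ∈ A`; `Ker α = A ⊕ Kx`. -/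
def TypeC (br : L →ₗ[K] L →ₗ[K] L) (M kerα : Submodule K L) : Prop :=
  ∃ (A : Submodule K L) (x y : L),
    x ∉ A ∧ y ∉ A ⊔ Submodule.span K {x} ∧
    M = A ⊔ Submodule.span K {x} ⊔ Submodule.span K {y} ∧
    IsAbelian br A ∧ (∀ a ∈ A, ad br x a = a) ∧ (∀ a ∈ A, ad br y a ∈ A) ∧
    br x y ∈ A ∧
    kerα = A ⊔ Submodule.span K {x}

/-- `M = A ⊕ Kx ⊕ Ky`, `A` is abelian, `ad x : A → A` is the identity, `ad y : A → A` is zero,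
`[x, y] = a + σ y` for some `a ∈ A` and `σ ≠ 0`; `Ker α = A ⊕ Kx`. -/
def TypeD (br : L →ₗ[K] L →ₗ[K] L) (M kerα : Submodule K L) : Prop :=
  ∃ (A : Submodule K L) (x y : L),
    x ∉ A ∧ y ∉ A ⊔ Submodule.span K {x} ∧
    M = A ⊔ Submodule.span K {x} ⊔ Submodule.span K {y} ∧
    IsAbelian br A ∧ (∀ a ∈ A, ad br x a = a) ∧ (∀ a ∈ A, ad br y a = 0) ∧
    (∃ a ∈ A, ∃ σ : K, σ ≠ 0 ∧ br x y = a + σ • y) ∧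
    kerα = A ⊔ Submodule.span K {x}

/-- The list of possible structures of a Lie subalgebra `M` of codimension `1`, together with
the kernel of the linear form `α` on it: `Ker α` is a subalgebra of codimension `1` in `M`,
and the pair `(M, Ker α)` is of one of the four explicit types. -/
def IsListed (br : L →ₗ[K] L →ₗ[K] L) (M kerα : Submodule K L) : Prop :=
  IsSubalgebra br kerα ∧ Module.finrank K kerα + 1 = Module.finrank K M ∧
    (TypeA br M kerα ∨ TypeB br M kerα ∨ TypeC br M kerα ∨ TypeD br M kerα)

end OmegaLie

/-!
Let `N = ker ω`. Expanding `[[x, y], [z, t]]` in two ways by the `ω`-Jacobi identity, one obtains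
an identity in which all products of degree four cancel. In dimension at least `4` it forces `ω`
to have rank `2`: two mutually orthogonal hyperbolic pairs are excluded in dimension `4`, `5`, `6`
by taking traces, and in larger dimension by a common eigenvector, orthogonal to all four vectors.
So `ω` is an area form on the plane `L ⧸ N`, and on `N` the same identity reads
`[z, t] = l(z) t - l(t) z`, where `l(z)` is the trace of `z` acting on `L ⧸ N`.

If `l = 0`, then `N` is abelian and acts on the plane by commuting traceless operators, all
multiples of a single one. If they have a common kernel vector `y ∉ N`, then `M = N ⊕ Ky` is of
type (a). Otherwise some `z ≠ 0` in `N` acts by zero on the plane, and then `[z, L] = 0`; this is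
absurd since the `ω`-Jacobi identity gives `ω(u, v) z = 0`.

If `l ≠ 0`, then `N` is almost abelian with abelian part `A = N ∩ ker l`. Choose `x` in `N` with
`l(x) = -1`. If `A` acts by zero on the plane, then `(ad a)³ = 0` for all `a` in `A`. Otherwise
some `a` in `A` acts nontrivially, and since `[a, x] = a` its action is nilpotent and its image is
an eigenline of `x`; a suitable `y` on that line modulo `N` makes `N ⊕ Ky` of type (d).
-/

namespace OmegaLie

variable {K L : Type*} [Field K] [AddCommGroup L] [Module K L]
  {br : L →ₗ[K] L →ₗ[K] L} {ω : L →ₗ[K] L →ₗ[K] K}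

/-! ### The fundamental identity of degree four -/

/-- The coboundary of `ω`: the cyclic sum `ω([x, y], z) + ω([z, x], y) + ω([y, z], x)`, as a
linear form in `z`. It measures the failure of `ω` to be a `2`-cocycle. -/
def coboundary (br : L →ₗ[K] L →ₗ[K] L) (ω : L →ₗ[K] L →ₗ[K] K) (x y : L) : L →ₗ[K] K :=
  ω (br x y) + ω.flip y ∘ₗ br.flip x + ω.flip x ∘ₗ br y

lemma coboundary_apply (x y z : L) :
    coboundary br ω x y z = ω (br x y) z + ω (br z x) y + ω (br y z) x := rfl

lemma coboundary_rotate (x y z : L) : coboundary br ω x y z = coboundary br ω y z x := by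
  simp only [coboundary_apply]
  ring

namespace IsOmegaLieAlgebra

lemma isAlt (hL : IsOmegaLieAlgebra br ω) : br.IsAlt := hL.bracket_self

lemma bracket_swap (hL : IsOmegaLieAlgebra br ω) (x y : L) : br x y = -br y x :=
  (hL.isAlt.neg y x).symm

lemma coboundary_swap (hL : IsOmegaLieAlgebra br ω) (x y z : L) :
    coboundary br ω x y z = -coboundary br ω y x z := by
  simp only [coboundary_apply, hL.bracket_swap y x, hL.bracket_swap z x, hL.bracket_swap z y,
    map_neg, LinearMap.neg_apply]
  ring

lemma jacobi_sorted (hL : IsOmegaLieAlgebra br ω) (hω : ω.IsAlt) (x y z : L) :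
    br (br x y) z - br (br x z) y + br (br y z) x = ω x y • z - ω x z • y + ω y z • x := by
  have h := hL.omega_jacobi x y z
  rw [hL.bracket_swap z x, ← hω.neg x z] at h
  simp only [map_neg, LinearMap.neg_apply, neg_smul] at h
  rw [sub_eq_add_neg, sub_eq_add_neg]
  exact h

lemma bracket_bracket (hL : IsOmegaLieAlgebra br ω) (hω : ω.IsAlt) (x y z t : L) :
    br (br x y) (br z t) = -br (br (br z t) x) y + br (br (br z t) y) x + ω x y • br z t
      + ω (br z t) x • y - ω (br z t) y • x := by
  have h := hL.jacobi_sorted hω x y (br z t)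
  rw [hL.bracket_swap x (br z t), hL.bracket_swap y (br z t), ← hω.neg (br z t) x,
    ← hω.neg (br z t) y] at h
  simp only [map_neg, LinearMap.neg_apply] at h
  linear_combination (norm := module) h

/-- `[[x, y], [z, t]] + [[z, t], [x, y]] = 0`, both brackets being expanded by the
`ω`-Jacobi identity. -/
lemma bracket_bracket_anticomm (hL : IsOmegaLieAlgebra br ω) (hω : ω.IsAlt) (x y z t : L) :
    -br (br (br z t) x) y + br (br (br z t) y) x - br (br (br x y) z) t + br (br (br x y) t) z
      + ω x y • br z t + ω z t • br x y + ω (br z t) x • y - ω (br z t) y • x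
      + ω (br x y) z • t - ω (br x y) t • z = 0 := by
  have h := hL.bracket_swap (br x y) (br z t)
  rw [hL.bracket_bracket hω x y z t, hL.bracket_bracket hω z t x y] at h
  linear_combination (norm := module) h

lemma jacobi_bracket (hL : IsOmegaLieAlgebra br ω) (hω : ω.IsAlt) (x y z t : L) :
    br (br (br x y) z) t - br (br (br x z) y) t + br (br (br y z) x) t
      = ω x y • br z t - ω x z • br y t + ω y z • br x t := by
  have h := congrArg (fun w => br w t) (hL.jacobi_sorted hω x y z)
  simpa only [map_add, map_sub, map_smul, LinearMap.add_apply, LinearMap.sub_apply,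
    LinearMap.smul_apply] using h

/-- The fundamental identity of degree four: the alternating sum of the identities
`bracket_bracket_anticomm` over the three splittings of `{x, y, z, t}` into pairs, in which the
brackets of degree four cancel by `jacobi_bracket`. -/
lemma four_identity (hL : IsOmegaLieAlgebra br ω) (hω : ω.IsAlt) (x y z t : L) :
    ω x y • br z t + ω z t • br x y - ω x z • br y t - ω y t • br x z
        + ω x t • br y z + ω y z • br x t
      = coboundary br ω x y z • t - coboundary br ω x y t • z + coboundary br ω x z t • y
        - coboundary br ω y z t • x := by
  have e1 := hL.bracket_bracket_anticomm hω x y z t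
  have e2 := hL.bracket_bracket_anticomm hω x z y t
  have e3 := hL.bracket_bracket_anticomm hω x t y z
  have j1 := hL.jacobi_bracket hω x y z t
  have j2 := hL.jacobi_bracket hω x y t z
  have j3 := hL.jacobi_bracket hω x z t y
  have j4 := hL.jacobi_bracket hω y z t x
  rw [hL.bracket_swap t z] at j2
  rw [hL.bracket_swap t y, hL.bracket_swap z y] at j3
  rw [hL.bracket_swap t x, hL.bracket_swap z x, hL.bracket_swap y x] at j4
  simp only [coboundary_apply, hL.bracket_swap z x, hL.bracket_swap t x, hL.bracket_swap t y,
    map_neg, LinearMap.neg_apply]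
  linear_combination (norm := module) -e1 + e2 - e3 - j1 + j2 - j3 + j4

section Trace

variable [FiniteDimensional K L]

lemma trace_bracket (hL : IsOmegaLieAlgebra br ω) (hω : ω.IsAlt) (x y : L) :
    LinearMap.trace K L (br (br x y)) = ((Module.finrank K L : K) - 2) * ω x y := by
  have h : br (br x y) + (br y * br x - br x * br y)
      = ω x y • (1 : Module.End K L) - (ω x).smulRight y + (ω y).smulRight x := by
    ext z
    have := hL.jacobi_sorted hω x y z
    simp only [LinearMap.add_apply, LinearMap.sub_apply, Module.End.mul_apply,
      LinearMap.smul_apply, Module.End.one_apply, LinearMap.smulRight_apply]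
    rw [← this, hL.bracket_swap (br x z), hL.bracket_swap (br y z)]
    abel
  have t := congrArg (LinearMap.trace K L) h
  simp only [map_add, map_sub, map_smul, LinearMap.trace_smulRight, LinearMap.trace_one,
    LinearMap.trace_mul_comm K (br y) (br x), sub_self, add_zero, smul_eq_mul] at t
  rw [t, ← hω.neg x y]
  ring

lemma finrank_sub_two_mul_coboundary (hL : IsOmegaLieAlgebra br ω) (hω : ω.IsAlt)
    (x y z : L) :
    ((Module.finrank K L : K) - 2) * coboundary br ω x y z
      = ω x y * LinearMap.trace K L (br z) - ω x z * LinearMap.trace K L (br y)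
        + ω y z * LinearMap.trace K L (br x) := by
  have h : ω x y • br z + (ω z).smulRight (br x y) - ω x z • br y - (ω y).smulRight (br x z)
        + (ω x).smulRight (br y z) + ω y z • br x
      = coboundary br ω x y z • (1 : Module.End K L) - (coboundary br ω x y).smulRight z
        + (coboundary br ω x z).smulRight y - (coboundary br ω y z).smulRight x := by
    ext t
    simpa only [LinearMap.add_apply, LinearMap.sub_apply, LinearMap.smul_apply,
      Module.End.one_apply, LinearMap.smulRight_apply] using hL.four_identity hω x y z t
  have t := congrArg (LinearMap.trace K L) h
  simp only [map_add, map_sub, map_smul, LinearMap.trace_smulRight, LinearMap.trace_one,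
    smul_eq_mul, ← coboundary_rotate x y z, hL.coboundary_swap x z,
    coboundary_rotate z x y] at t
  have expand : coboundary br ω x y z = -ω z (br x y) + ω y (br x z) - ω x (br y z) := by
    rw [coboundary_apply, hL.bracket_swap z x, hω.neg, map_neg, LinearMap.neg_apply, hω.neg,
      ← hω.neg x, sub_eq_add_neg]
  linear_combination expand - t

end Trace

end IsOmegaLieAlgebra

/-! ### The rank of the form -/

lemma rank_quotient_ker_pi_le {k : ℕ} (f : Fin k → Module.Dual K L) :
    Module.rank K (L ⧸ LinearMap.ker (LinearMap.pi f)) ≤ k := by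
  have h := LinearMap.lift_rank_le_of_injective
    ((LinearMap.ker (LinearMap.pi f)).liftQ (LinearMap.pi f) le_rfl)
    (LinearMap.ker_eq_bot.mp (Submodule.ker_liftQ_eq_bot _ _ _ le_rfl))
  simpa using h

lemma exists_ne_zero_forall_apply_eq_zero {k : ℕ} (f : Fin k → Module.Dual K L)
    (hk : k < Module.rank K L) : ∃ q : L, q ≠ 0 ∧ ∀ i, f i q = 0 := by
  have hker : LinearMap.ker (LinearMap.pi f) ≠ ⊥ := fun h => by
    refine hk.not_ge ?_
    rw [← (Submodule.quotEquivOfEqBot _ h).rank_eq]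
    exact rank_quotient_ker_pi_le f
  obtain ⟨q, hq, hq0⟩ := Submodule.exists_mem_ne_zero_of_ne_bot hker
  exact ⟨q, hq0, congrFun hq⟩

/-- Two mutually orthogonal hyperbolic pairs `(u, v)` and `(u', v')`. They exist exactly when
the rank of the alternating form `ω` exceeds `2`. -/
structure OrthPairs (ω : L →ₗ[K] L →ₗ[K] K) (u v u' v' : L) : Prop where
  left : ω u v = 1
  right : ω u' v' = 1
  uu : ω u u' = 0
  uv : ω u v' = 0
  vu : ω v u' = 0
  vv : ω v v' = 0

/-- The vector `p` is orthogonal to all of `u, v, u', v'`. -/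
structure OrthTo (ω : L →ₗ[K] L →ₗ[K] K) (u v u' v' p : L) : Prop where
  u : ω u p = 0
  v : ω v p = 0
  u' : ω u' p = 0
  v' : ω v' p = 0

section OrthPairs

variable {u v u' v' p q : L}

namespace OrthPairs

lemma symm (h : OrthPairs ω u v u' v') (hω : ω.IsAlt) : OrthPairs ω u' v' u v where
  left := h.right
  right := h.left
  uu := hω.isRefl.eq_zero h.uu
  uv := hω.isRefl.eq_zero h.vu
  vu := hω.isRefl.eq_zero h.uv
  vv := hω.isRefl.eq_zero h.vv

lemma rotate_left (h : OrthPairs ω u v u' v') (hω : ω.IsAlt) : OrthPairs ω v (-u) u' v' where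
  left := by rw [map_neg, hω.neg, h.left]
  right := h.right
  uu := h.vu
  uv := h.vv
  vu := by simp [h.uu]
  vv := by simp [h.uv]

lemma rotate_right (h : OrthPairs ω u v u' v') (hω : ω.IsAlt) : OrthPairs ω u v v' (-u') :=
  ((h.symm hω).rotate_left hω).symm hω

lemma shear (h : OrthPairs ω u v u' v') (hω : ω.IsAlt) :
    OrthPairs ω u (v + u') u' (v' + u) where
  left := by simp [h.left, h.uu]
  right := by simp [h.right, (h.symm hω).uu]
  uu := h.uu
  uv := by simp [h.uv, hω.self_eq_zero]
  vu := by simp [h.vu, hω.self_eq_zero]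
  vv := by simp [h.vv, h.right, (h.symm hω).uu, ← hω.neg u v, h.left]

lemma eq_zero_of_eq_combination (h : OrthPairs ω u v u' v') (hω : ω.IsAlt)
    (hp : OrthTo ω u v u' v' p) {a b c d : K} (e : p = a • u + b • v + c • u' + d • v') :
    p = 0 := by
  have h' := h.symm hω
  have hb : b = 0 := by simpa [e, h.left, h.uu, h.uv, hω.self_eq_zero] using hp.u
  have ha : a = 0 := by simpa [e, ← hω.neg u v, h.left, h.vu, h.vv, hω.self_eq_zero] using hp.v
  have hd : d = 0 := by simpa [e, h.right, h'.uu, h'.uv, hω.self_eq_zero] using hp.u'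
  have hc : c = 0 := by
    simpa [e, ← hω.neg u' v', h.right, h'.vu, h'.vv, hω.self_eq_zero] using hp.v'
  simp [e, ha, hb, hc, hd]

end OrthPairs

namespace OrthTo

lemma symm (hp : OrthTo ω u v u' v' p) : OrthTo ω u' v' u v p :=
  ⟨hp.u', hp.v', hp.u, hp.v⟩

lemma rotate_left (hp : OrthTo ω u v u' v' p) : OrthTo ω v (-u) u' v' p :=
  ⟨hp.v, by simp [hp.u], hp.u', hp.v'⟩

lemma rotate_right (hp : OrthTo ω u v u' v' p) : OrthTo ω u v v' (-u') p :=
  hp.symm.rotate_left.symm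

lemma shear (hp : OrthTo ω u v u' v' p) : OrthTo ω u (v + u') u' (v' + u) p :=
  ⟨hp.u, by simp [hp.v, hp.u'], hp.u', by simp [hp.v', hp.u]⟩

lemma smul_sub_smul (hp : OrthTo ω u v u' v' p) (hq : OrthTo ω u v u' v' q) (a b : K) :
    OrthTo ω u v u' v' (a • p - b • q) :=
  ⟨by simp [hp.u, hq.u], by simp [hp.v, hq.v], by simp [hp.u', hq.u'], by simp [hp.v', hq.v']⟩

end OrthTo

namespace IsOmegaLieAlgebra

/-- Apply `θ` to the fundamental identity for `u, v, u', v'`: the coboundary terms cancel in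
pairs. -/
lemma two_mul_sq_eq_zero_of_orthPairs (hL : IsOmegaLieAlgebra br ω) (hω : ω.IsAlt)
    (h : OrthPairs ω u v u' v') (θ : Module.Dual K L) {c : K}
    (huv : θ (br u v) = c) (huv' : θ (br u' v') = c)
    (hu : c * coboundary br ω u' v' u = θ u) (hv : c * coboundary br ω u' v' v = θ v)
    (hu' : c * coboundary br ω u v u' = θ u') (hv' : c * coboundary br ω u v v' = θ v') :
    2 * c ^ 2 = 0 := by
  have e := congrArg θ (hL.four_identity hω u v u' v')
  simp only [h.left, h.right, h.uu, h.uv, h.vu, h.vv, coboundary_rotate u u' v',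
    coboundary_rotate v u' v', map_add, map_sub, map_smul, smul_eq_mul, one_mul, zero_mul,
    sub_zero, add_zero, huv, huv'] at e
  linear_combination c * e + θ v' * hu' - θ u' * hv' + θ v * hu - θ u * hv

lemma finrank_sub_two_eq_zero_of_orthPairs [FiniteDimensional K L]
    (hL : IsOmegaLieAlgebra br ω) (hω : ω.IsAlt) (h2 : (2 : K) ≠ 0)
    (h : OrthPairs ω u v u' v') : (Module.finrank K L : K) - 2 = 0 := by
  have h' := h.symm hω
  have key := hL.two_mul_sq_eq_zero_of_orthPairs hω h (LinearMap.trace K L ∘ₗ br)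
    (c := (Module.finrank K L : K) - 2)
    (by simp [hL.trace_bracket hω, h.left]) (by simp [hL.trace_bracket hω, h.right])
    (by simp [hL.finrank_sub_two_mul_coboundary hω, h'.left, h'.uu, h'.vu])
    (by simp [hL.finrank_sub_two_mul_coboundary hω, h'.left, h'.uv, h'.vv])
    (by simp [hL.finrank_sub_two_mul_coboundary hω, h.left, h.uu, h.vu])
    (by simp [hL.finrank_sub_two_mul_coboundary hω, h.left, h.uv, h.vv])
  exact pow_eq_zero_iff two_ne_zero |>.mp ((mul_eq_zero.mp key).resolve_left h2)

lemma bracket_add_smul_of_orth (hL : IsOmegaLieAlgebra br ω) (hω : ω.IsAlt)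
    (huv : ω u v = 1) (hup : ω u p = 0) (hvp : ω v p = 0) (huq : ω u q = 0) (hvq : ω v q = 0) :
    br p q + ω p q • br u v = coboundary br ω u v p • q - coboundary br ω u v q • p
      + coboundary br ω u p q • v - coboundary br ω v p q • u := by
  have h := hL.four_identity hω u v p q
  simpa only [huv, hup, hvp, huq, hvq, one_smul, zero_smul, sub_zero, add_zero] using h

lemma omega_bracket_opposite (hL : IsOmegaLieAlgebra br ω) (hω : ω.IsAlt)
    (h : OrthPairs ω u v u' v') (hp : OrthTo ω u v u' v' p) :
    ω (br u' v') p = -ω (br u v) p := by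
  have e := congrArg (fun w => ω w p) (hL.bracket_add_smul_of_orth hω h.left h.uu h.vu h.uv h.vv)
  simp only [map_add, map_sub, map_smul, LinearMap.add_apply, LinearMap.sub_apply,
    LinearMap.smul_apply, smul_eq_mul, hp.u, hp.v, hp.u', hp.v', h.right, mul_zero, sub_zero,
    add_zero, one_mul] at e
  linear_combination e

lemma coboundary_eq_two_mul_sub (hL : IsOmegaLieAlgebra br ω) (hω : ω.IsAlt)
    (h : OrthPairs ω u v u' v') (hp : OrthTo ω u v u' v' p) :
    coboundary br ω u' v' p = 2 * coboundary br ω u v p - ω (br u v) p := by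
  have e : ω (br p u') v' = coboundary br ω u v p := by
    have e := hL.bracket_add_smul_of_orth hω h.left hp.u hp.v h.uu h.vu
    rw [hω.isRefl.eq_zero hp.u', zero_smul, add_zero] at e
    simp [e, h.right, h.uv, h.vv, hω.isRefl.eq_zero hp.v']
  have e' : ω (br v' p) u' = coboundary br ω u v p := by
    have e := hL.bracket_add_smul_of_orth hω h.left h.uv h.vv hp.u hp.v
    rw [hp.v', zero_smul, add_zero] at e
    simp [e, ← hω.neg u' v', h.right, h.uu, h.vu, hω.isRefl.eq_zero hp.u']
  rw [coboundary_apply, e, e', hL.omega_bracket_opposite hω h hp]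
  ring

lemma coboundary_opposite (hL : IsOmegaLieAlgebra br ω) (hω : ω.IsAlt)
    (h : OrthPairs ω u v u' v') (hp : OrthTo ω u v u' v' p) :
    coboundary br ω u' v' p = -coboundary br ω u v p := by
  linear_combination -hL.coboundary_eq_two_mul_sub hω h hp
    - hL.coboundary_eq_two_mul_sub hω (h.symm hω) hp.symm + hL.omega_bracket_opposite hω h hp

/-- Both hyperbolic pairs compute `[p, q]`; by `coboundary_opposite` the two results differ by
twice the difference of the sides, modulo the span of `u, v, u', v'`. -/
lemma coboundary_smul_comm (hL : IsOmegaLieAlgebra br ω) (hω : ω.IsAlt) (h2 : (2 : K) ≠ 0)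
    (h : OrthPairs ω u v u' v') (hp : OrthTo ω u v u' v' p) (hq : OrthTo ω u v u' v' q)
    (hpq : ω p q = 0) : coboundary br ω u v p • q = coboundary br ω u v q • p := by
  have e := hL.bracket_add_smul_of_orth hω h.left hp.u hp.v hq.u hq.v
  have e' := hL.bracket_add_smul_of_orth hω h.right hp.u' hp.v' hq.u' hq.v'
  rw [hL.coboundary_opposite hω h hp, hL.coboundary_opposite hω h hq] at e'
  rw [hpq, zero_smul, add_zero] at e e'
  have key := h.eq_zero_of_eq_combination hω
    (hq.smul_sub_smul hp (2 * coboundary br ω u v p) (2 * coboundary br ω u v q))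
    (a := coboundary br ω v p q) (b := -coboundary br ω u p q)
    (c := -coboundary br ω v' p q) (d := coboundary br ω u' p q)
    (by linear_combination (norm := module) e' - e)
  rw [mul_smul, mul_smul, ← smul_sub] at key
  exact sub_eq_zero.mp ((smul_eq_zero.mp key).resolve_left h2)

lemma coboundary_eq_zero_of_orthTo (hL : IsOmegaLieAlgebra br ω) (hω : ω.IsAlt)
    (h2 : (2 : K) ≠ 0) (hn : 6 < Module.rank K L) (h : OrthPairs ω u v u' v')
    (hp : OrthTo ω u v u' v' p) : coboundary br ω u v p = 0 := by
  by_cases hp0 : p = 0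
  · rw [hp0, map_zero]
  obtain ⟨φ, hφ⟩ := Module.Projective.exists_dual_eq_one K hp0
  obtain ⟨q, hq0, hq⟩ :=
    exists_ne_zero_forall_apply_eq_zero ![ω u, ω v, ω u', ω v', ω p, φ] (mod_cast hn)
  have e := hL.coboundary_smul_comm hω h2 h hp ⟨hq 0, hq 1, hq 2, hq 3⟩ (hq 4)
  have hqφ : φ q = 0 := hq 5
  have hfq : coboundary br ω u v q = 0 := by simpa [hφ, hqφ, eq_comm] using congrArg φ e
  rw [hfq, zero_smul] at e
  exact (smul_eq_zero.mp e).resolve_right hq0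

lemma coboundary_cross_eq_zero (hL : IsOmegaLieAlgebra br ω) (hω : ω.IsAlt)
    (h2 : (2 : K) ≠ 0) (hn : 6 < Module.rank K L) (h : OrthPairs ω u v u' v')
    (hp : OrthTo ω u v u' v' p) : coboundary br ω u u' p = 0 := by
  have e := hL.coboundary_eq_zero_of_orthTo hω h2 hn (h.shear hω) hp.shear
  have e' := hL.coboundary_eq_zero_of_orthTo hω h2 hn h hp
  rw [coboundary_rotate, coboundary_rotate] at e e' ⊢
  rwa [map_add, e', zero_add] at e

lemma bracket_eq_smul_of_orthTo (hL : IsOmegaLieAlgebra br ω) (hω : ω.IsAlt)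
    (h2 : (2 : K) ≠ 0) (hn : 6 < Module.rank K L) (h : OrthPairs ω u v u' v')
    (hp : OrthTo ω u v u' v' p) : br u p = coboundary br ω u' v' u • p := by
  have e := hL.four_identity hω u' v' p u
  have h' := h.symm hω
  have z : coboundary br ω u' p u = 0 := by
    rw [← coboundary_rotate, hL.coboundary_cross_eq_zero hω h2 hn h hp]
  have z' : coboundary br ω v' p u = 0 := by
    rw [← coboundary_rotate,
      hL.coboundary_cross_eq_zero hω h2 hn (h.rotate_right hω) hp.rotate_right]
  rw [hL.coboundary_eq_zero_of_orthTo hω h2 hn h' hp.symm, z, z', h'.left, h'.uu, h'.vu, hp.u',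
    hp.v', hω.isRefl.eq_zero hp.u] at e
  rw [hL.bracket_swap u p]
  linear_combination (norm := module) -e

lemma bracket_bracket_eq_self_of_orthTo (hL : IsOmegaLieAlgebra br ω) (hω : ω.IsAlt)
    (h2 : (2 : K) ≠ 0) (hn : 6 < Module.rank K L) (h : OrthPairs ω u v u' v')
    (hp : OrthTo ω u v u' v' p) : br (br u v) p = p := by
  have e := hL.jacobi_sorted hω u v p
  rw [hL.bracket_eq_smul_of_orthTo hω h2 hn h hp,
    hL.bracket_eq_smul_of_orthTo hω h2 hn (h.rotate_left hω) hp.rotate_left, map_smul, map_smul,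
    LinearMap.smul_apply, LinearMap.smul_apply, hL.bracket_swap p u, hL.bracket_swap p v,
    hL.bracket_eq_smul_of_orthTo hω h2 hn h hp,
    hL.bracket_eq_smul_of_orthTo hω h2 hn (h.rotate_left hω) hp.rotate_left, h.left, hp.u, hp.v]
    at e
  linear_combination (norm := module) e

/-- A common eigenvector `p` of `u, v, u', v'` supplies the linear form `θ a = φ [a, p]` of
`two_mul_sq_eq_zero_of_orthPairs`. -/
lemma not_orthPairs_of_six_lt_rank (hL : IsOmegaLieAlgebra br ω) (hω : ω.IsAlt)
    (h2 : (2 : K) ≠ 0) (hn : 6 < Module.rank K L) : ¬OrthPairs ω u v u' v' := by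
  intro h
  obtain ⟨p, hp0, hp'⟩ := exists_ne_zero_forall_apply_eq_zero ![ω u, ω v, ω u', ω v']
    (lt_trans (by norm_num) hn)
  have hp : OrthTo ω u v u' v' p := ⟨hp' 0, hp' 1, hp' 2, hp' 3⟩
  obtain ⟨φ, hφ⟩ := Module.Projective.exists_dual_eq_one K hp0
  have eigen {x y x' y' : L} (h : OrthPairs ω x y x' y') (hp : OrthTo ω x y x' y' p) :
      1 * coboundary br ω x' y' x = (φ ∘ₗ br.flip p) x := by
    simp [hL.bracket_eq_smul_of_orthTo hω h2 hn h hp, hφ]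
  have unit {x y x' y' : L} (h : OrthPairs ω x y x' y') (hp : OrthTo ω x y x' y' p) :
      (φ ∘ₗ br.flip p) (br x y) = 1 := by
    simp [hL.bracket_bracket_eq_self_of_orthTo hω h2 hn h hp, hφ]
  have h' := h.symm hω
  refine h2 ?_
  simpa using hL.two_mul_sq_eq_zero_of_orthPairs hω h _ (unit h hp) (unit h' hp.symm)
    (eigen h hp) (eigen (h.rotate_left hω) hp.rotate_left) (eigen h' hp.symm)
    (eigen (h'.rotate_left hω) hp.symm.rotate_left)

lemma not_orthPairs (hL : IsOmegaLieAlgebra br ω) (hω : ω.IsAlt) (h2 : (2 : K) ≠ 0)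
    (hn : 4 ≤ Module.rank K L) (h5 : (3 : K) = 0 → Module.rank K L ≠ 5) :
    ¬OrthPairs ω u v u' v' := by
  intro h
  have hle : Module.rank K L ≤ 6 :=
    not_lt.mp fun hlt => hL.not_orthPairs_of_six_lt_rank hω h2 hlt h
  have : FiniteDimensional K L :=
    Module.rank_lt_aleph0_iff.mp (hle.trans_lt Cardinal.ofNat_lt_aleph0)
  rw [← Module.finrank_eq_rank] at hn hle h5
  norm_cast at hn hle h5
  have hc := hL.finrank_sub_two_eq_zero_of_orthPairs hω h2 h
  obtain hd | hd | hd : Module.finrank K L = 4 ∨ Module.finrank K L = 5 ∨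
    Module.finrank K L = 6 := by omega
  all_goals rw [hd] at hc
  · exact h2 (by linear_combination hc)
  · exact h5 (by linear_combination hc) hd
  · exact mul_ne_zero h2 h2 (by linear_combination hc)

end IsOmegaLieAlgebra

end OrthPairs

/-- The form `ω` has rank at most `2`: a vector orthogonal to both members of a pair on which
`ω` does not vanish lies in the kernel of `ω`. -/
def HasRankLETwo (ω : L →ₗ[K] L →ₗ[K] K) : Prop :=
  ∀ x y p : L, ω x y ≠ 0 → ω p x = 0 → ω p y = 0 → ω p = 0

lemma OrthPairs.of_omega_ne_zero (hω : ω.IsAlt) {x y p w : L} (hxy : ω x y ≠ 0)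
    (hpx : ω p x = 0) (hpy : ω p y = 0) (hpw : ω p w ≠ 0) :
    ∃ u v u' v', OrthPairs ω u v u' v' := by
  obtain ⟨hxp, hyp⟩ := And.intro (hω.isRefl.eq_zero hpx) (hω.isRefl.eq_zero hpy)
  have hyx : ω y x = -ω x y := (hω.neg x y).symm
  refine ⟨(ω x y)⁻¹ • x, y, (ω p w)⁻¹ • p,
    w - (ω x w / ω x y) • y + (ω y w / ω x y) • x, ?_, ?_, ?_, ?_, ?_, ?_⟩
  all_goals simp [*, hω.self_eq_zero]

lemma IsOmegaLieAlgebra.hasRankLETwo (hL : IsOmegaLieAlgebra br ω) (hω : ω.IsAlt)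
    (h2 : (2 : K) ≠ 0) (hn : 4 ≤ Module.rank K L) (h5 : (3 : K) = 0 → Module.rank K L ≠ 5) :
    HasRankLETwo ω := by
  intro x y p hxy hpx hpy
  ext w
  by_contra hpw
  obtain ⟨u, v, u', v', h⟩ := OrthPairs.of_omega_ne_zero hω hxy hpx hpy hpw
  exact hL.not_orthPairs hω h2 hn h5 h

/-! ### Alternation and Lie subalgebras -/

lemma jacobi_of_smul_eq (halt : br.IsAlt) {x y z : L} {a b c : K} (hc : c ≠ 0)
    (e : c • z = a • x + b • y) : br (br x y) z + br (br z x) y + br (br y z) x = 0 := by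
  obtain rfl : z = c⁻¹ • (a • x + b • y) := by rw [← e, inv_smul_smul₀ hc]
  simp only [map_smul, map_add, LinearMap.smul_apply, LinearMap.add_apply, halt.self_eq_zero,
    ← halt.neg x y, map_neg, LinearMap.neg_apply, map_zero, LinearMap.zero_apply]
  module

lemma linearIndependent_of_jacobi_ne_zero (halt : br.IsAlt) {x y z : L}
    (h : br (br x y) z + br (br z x) y + br (br y z) x ≠ 0) : LinearIndependent K ![x, y, z] := by
  contrapose! h
  obtain ⟨g, hg, i, hi⟩ := Fintype.not_linearIndependent_iff.mp h
  simp only [Fin.sum_univ_three, Matrix.cons_val] at hg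
  fin_cases i
  · rw [← add_rotate]
    exact jacobi_of_smul_eq halt (c := g 0) (a := -g 1) (b := -g 2) hi
      (by linear_combination (norm := module) hg)
  · rw [add_rotate]
    exact jacobi_of_smul_eq halt (c := g 1) (a := -g 2) (b := -g 0) hi
      (by linear_combination (norm := module) hg)
  · exact jacobi_of_smul_eq halt (c := g 2) (a := -g 0) (b := -g 1) hi
      (by linear_combination (norm := module) hg)

lemma isLieAlgebra_of_jacobi (halt : br.IsAlt)
    (h : ∀ x y z, br (br x y) z + br (br z x) y + br (br y z) x = 0) : IsLieAlgebra br :=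
  ⟨fun _ _ _ _ => trivial, fun x _ => halt x, fun x _ y _ z _ => h x y z⟩

namespace IsOmegaLieAlgebra

lemma three_le_rank (hL : IsOmegaLieAlgebra br ω) (hnotLie : ¬IsLieAlgebra br) :
    3 ≤ Module.rank K L := by
  by_contra hlt
  refine hnotLie (isLieAlgebra_of_jacobi hL.isAlt fun x y z => ?_)
  by_contra h
  exact hlt (by simpa using (linearIndependent_of_jacobi_ne_zero hL.isAlt h).cardinal_lift_le_rank)

lemma omega_isAlt (hL : IsOmegaLieAlgebra br ω) (hn : 2 ≤ Module.rank K L) : ω.IsAlt := by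
  intro x
  have hspan : ¬∀ z : L, ∃ r : K, r • x = z := fun h =>
    absurd (hn.trans (rank_le_one_iff.mpr ⟨x, h⟩)) (by norm_num)
  push Not at hspan
  obtain ⟨z, hz⟩ := hspan
  by_contra hxx
  refine hz (-(ω x x)⁻¹ * (ω z x + ω x z)) ?_
  have h := hL.omega_jacobi x x z
  rw [hL.bracket_self, hL.bracket_swap z x] at h
  simp only [map_zero, map_neg, LinearMap.zero_apply, LinearMap.neg_apply] at h
  linear_combination (norm := module) (ω x x)⁻¹ • h + inv_smul_smul₀ hxx z

lemma omega_ne_zero (hL : IsOmegaLieAlgebra br ω) (hnotLie : ¬IsLieAlgebra br) : ω ≠ 0 := by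
  rintro rfl
  exact hnotLie (isLieAlgebra_of_jacobi hL.isAlt fun x y z => by simpa using hL.omega_jacobi x y z)

lemma isLieSubalgebra (hL : IsOmegaLieAlgebra br ω) {S : Submodule K L}
    (hS : IsSubalgebra br S) (hiso : ∀ x ∈ S, ∀ y ∈ S, ω x y = 0) : IsLieSubalgebra br S where
  isSubalgebra := hS
  bracket_self x _ := hL.bracket_self x
  jacobi x hx y hy z hz := by
    simp [hL.omega_jacobi x y z, hiso x hx y hy, hiso z hz x hx, hiso y hy z hz]

lemma isSubalgebra_sup_span_singleton (hL : IsOmegaLieAlgebra br ω) {S : Submodule K L} {y : L}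
    (hS : IsSubalgebra br S) (hy : ∀ s ∈ S, br s y ∈ S ⊔ Submodule.span K {y}) :
    IsSubalgebra br (S ⊔ Submodule.span K {y}) := by
  intro p hp q hq
  simp only [Submodule.mem_sup, Submodule.mem_span_singleton] at hp hq
  obtain ⟨s, hs, _, ⟨a, rfl⟩, rfl⟩ := hp
  obtain ⟨t, ht, _, ⟨b, rfl⟩, rfl⟩ := hq
  have e : br (s + a • y) (t + b • y) = br s t + b • br s y - a • br t y := by
    simp only [map_add, map_smul, LinearMap.add_apply, LinearMap.smul_apply, hL.bracket_self,
      hL.bracket_swap y t]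
    module
  rw [e]
  exact sub_mem (add_mem (Submodule.mem_sup_left (hS s hs t ht)) (Submodule.smul_mem _ _ (hy s hs)))
    (Submodule.smul_mem _ _ (hy t ht))

end IsOmegaLieAlgebra

/-! ### The kernel of the form -/

lemma isCoatom_ker_flip {y : L} (hω : ω.IsAlt) (hy : ω y ≠ 0) :
    IsCoatom (LinearMap.ker (ω.flip y)) := by
  refine LinearMap.isCoatom_ker_of_surjective (LinearMap.surjective fun h => hy ?_)
  ext w
  exact hω.isRefl.eq_zero (LinearMap.congr_fun h w)

lemma inf_ker_sup_span_singleton {M : Submodule K L} {φ : Module.Dual K L} {y : L} (hy : y ∈ M)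
    (hφ : φ y ≠ 0) : M ⊓ LinearMap.ker φ ⊔ Submodule.span K {y} = M := by
  rw [sup_comm, inf_comm,
    ← sup_inf_assoc_of_le _ ((Submodule.span_singleton_le_iff_mem y M).mpr hy),
    LinearMap.span_singleton_sup_ker_eq_top φ hφ, top_inf_eq]

namespace HasRankLETwo

variable {u v : L}

lemma eq_zero_of_apply_eq_zero {V : Type*} [AddCommGroup V] [Module K V] (hR : HasRankLETwo ω)
    (hω : ω.IsAlt) (huv : ω u v ≠ 0) {φ : L →ₗ[K] V} (hker : ∀ w, ω w = 0 → φ w = 0)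
    (hu : φ u = 0) (hv : φ v = 0) : φ = 0 := by
  ext w
  have h := hker (ω u v • w - ω w v • u + ω w u • v) <| by
    refine hR u v _ huv ?_ ?_ <;> simp [hω.self_eq_zero, ← hω.neg u v, mul_comm]
  simpa [hu, hv, huv] using h

lemma ker_eq_ker_pi (hR : HasRankLETwo ω) (huv : ω u v ≠ 0) :
    LinearMap.ker ω = LinearMap.ker (LinearMap.pi ![ω.flip u, ω.flip v]) := by
  ext w
  simp only [LinearMap.mem_ker, funext_iff, LinearMap.pi_apply, Fin.forall_fin_two]
  exact ⟨fun h => by simp [h], fun h => hR u v w huv h.1 h.2⟩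

lemma rank_quotient_ker (hR : HasRankLETwo ω) (hω : ω.IsAlt) (huv : ω u v ≠ 0) :
    Module.rank K (L ⧸ LinearMap.ker ω) = 2 := by
  refine le_antisymm ?_ ?_
  · rw [hR.ker_eq_ker_pi huv]
    exact mod_cast rank_quotient_ker_pi_le ![ω.flip u, ω.flip v]
  · have hli : LinearIndependent K
        ![(LinearMap.ker ω).mkQ u, (LinearMap.ker ω).mkQ v] := by
      refine LinearIndependent.pair_iff.mpr fun s t hst => ?_
      rw [← map_smul, ← map_smul, ← map_add, ← LinearMap.mem_ker, Submodule.ker_mkQ,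
        LinearMap.mem_ker] at hst
      have hu := LinearMap.congr_fun hst u
      have hv := LinearMap.congr_fun hst v
      simp only [map_add, map_smul, LinearMap.add_apply, LinearMap.smul_apply, smul_eq_mul,
        hω.self_eq_zero, ← hω.neg u v, LinearMap.zero_apply] at hu hv
      simp_all
    simpa using hli.cardinal_lift_le_rank

lemma rank_quotient_ker_inf_ker (hR : HasRankLETwo ω) (huv : ω u v ≠ 0) (l : Module.Dual K L) :
    Module.rank K (L ⧸ (LinearMap.ker ω ⊓ LinearMap.ker l : Submodule K L)) ≤ 3 := by
  have h : LinearMap.ker ω ⊓ LinearMap.ker l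
      = LinearMap.ker (LinearMap.pi ![ω.flip u, ω.flip v, l]) := by
    rw [hR.ker_eq_ker_pi huv]
    ext w
    simp [funext_iff, Fin.forall_fin_succ, and_assoc]
  rw [h]
  exact mod_cast rank_quotient_ker_pi_le ![ω.flip u, ω.flip v, l]

lemma alphaKer_eq_ker (hR : HasRankLETwo ω) {y w : L}
    (hw : w ∉ LinearMap.ker (ω.flip y)) :
    alphaKer ω (LinearMap.ker (ω.flip y)) w = LinearMap.ker ω := by
  refine le_antisymm (fun x hx => ?_) fun x hx => ?_
  · exact hR w y x hw hx.2 hx.1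
  · exact ⟨LinearMap.congr_fun hx y, LinearMap.congr_fun hx w⟩

lemma ker_sup_span_singleton (hR : HasRankLETwo ω) (hω : ω.IsAlt) {y : L} (hy : ω y ≠ 0) :
    LinearMap.ker ω ⊔ Submodule.span K {y} = LinearMap.ker (ω.flip y) := by
  obtain ⟨v, hv⟩ : ∃ v, ω y v ≠ 0 := DFunLike.exists_ne hy
  rw [← hR.alphaKer_eq_ker (w := v) fun h => hv (hω.isRefl.eq_zero h)]
  exact inf_ker_sup_span_singleton (hω.self_eq_zero y) hv

end HasRankLETwo

namespace IsOmegaLieAlgebra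

lemma isSubalgebra_ker (hL : IsOmegaLieAlgebra br ω) (hω : ω.IsAlt) (h2 : (2 : K) ≠ 0) :
    IsSubalgebra br (LinearMap.ker ω) := by
  intro z (hz : ω z = 0) t (ht : ω t = 0)
  have hz' w : ω w z = 0 := hω.isRefl.eq_zero (LinearMap.congr_fun hz w)
  have ht' w : ω w t = 0 := hω.isRefl.eq_zero (LinearMap.congr_fun ht w)
  by_contra hzt
  obtain ⟨w, hw⟩ : ∃ w, ω (br z t) w ≠ 0 := DFunLike.exists_ne hzt
  obtain ⟨w', hw'⟩ : ∃ w', ω w w' ≠ 0 := ⟨_, fun h => hw (hω.isRefl.eq_zero h)⟩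
  have e := congrArg (fun p => ω p w) (hL.four_identity hω w w' z t)
  simp only [map_add, map_sub, map_smul, LinearMap.add_apply, LinearMap.sub_apply,
    LinearMap.smul_apply, smul_eq_mul, hz, ht, hz', ht', hω.self_eq_zero, coboundary_apply,
    LinearMap.zero_apply, mul_zero, zero_mul, sub_zero, add_zero, zero_add, ← hω.neg w w'] at e
  have : 2 * (ω w w' * ω (br z t) w) = 0 := by linear_combination e
  exact mul_ne_zero h2 (mul_ne_zero hw' hw) this

lemma omega_smul_bracket_ker (hL : IsOmegaLieAlgebra br ω) (hω : ω.IsAlt) (h2 : (2 : K) ≠ 0)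
    {z t : L} (hz : ω z = 0) (ht : ω t = 0) (x y : L) :
    ω x y • br z t = coboundary br ω x y z • t - coboundary br ω x y t • z := by
  have hz' w : ω w z = 0 := hω.isRefl.eq_zero (LinearMap.congr_fun hz w)
  have ht' w : ω w t = 0 := hω.isRefl.eq_zero (LinearMap.congr_fun ht w)
  have hzt : ω (br z t) = 0 := hL.isSubalgebra_ker hω h2 z hz t ht
  have hδ w : coboundary br ω w z t = 0 := by
    rw [coboundary_apply, ht', hz', hzt, LinearMap.zero_apply, zero_add, zero_add]
  simpa only [hδ, hz, hz', ht', LinearMap.zero_apply, zero_smul, add_zero, sub_zero]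
    using hL.four_identity hω x y z t

lemma jacobi_ker (hL : IsOmegaLieAlgebra br ω) (hω : ω.IsAlt) {z t : L} (hz : ω z = 0)
    (ht : ω t = 0) (w : L) : br (br z t) w = br z (br t w) - br t (br z w) := by
  have e := hL.jacobi_sorted hω z t w
  rw [hL.bracket_swap (br z w), hL.bracket_swap (br t w), hz, ht] at e
  simp only [LinearMap.zero_apply, zero_smul, sub_zero, add_zero] at e
  linear_combination (norm := module) e

lemma eq_zero_of_central (hL : IsOmegaLieAlgebra br ω) (hω : ω.IsAlt) (hω0 : ω ≠ 0) {z : L}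
    (hz : ω z = 0) (hcentral : ∀ w, br z w = 0) : z = 0 := by
  obtain ⟨u, hu⟩ : ∃ u, ω u ≠ 0 := DFunLike.exists_ne hω0
  obtain ⟨v, huv⟩ : ∃ v, ω u v ≠ 0 := DFunLike.exists_ne hu
  have e := hL.omega_jacobi u v z
  rw [hL.bracket_swap _ z, hL.bracket_swap v z, hcentral, hcentral, hcentral, hz,
    hω.isRefl.eq_zero (LinearMap.congr_fun hz v)] at e
  simpa [huv] using e.symm

end IsOmegaLieAlgebra

/-- The endomorphism `f` is an infinitesimal similitude of `ω` with multiplier `c`; for `c = 0` it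
is skew-adjoint. -/
def HasMultiplier (ω : L →ₗ[K] L →ₗ[K] K) (f : Module.End K L) (c : K) : Prop :=
  ∀ x y, ω (f x) y + ω x (f y) = c * ω x y

/-- On `N = ker ω`, the linear form `l` is the trace of the action of `N` on the plane `L ⧸ N`,
on which `ω` is an area form; it also determines the product of `N`. -/
structure IsKerTrace (br : L →ₗ[K] L →ₗ[K] L) (ω : L →ₗ[K] L →ₗ[K] K) (l : Module.Dual K L) :
    Prop where
  bracket : ∀ z, ω z = 0 → ∀ t, ω t = 0 → br z t = l z • t - l t • z
  hasMultiplier : ∀ z, ω z = 0 → HasMultiplier ω (br z) (l z)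

lemma IsOmegaLieAlgebra.exists_isKerTrace (hL : IsOmegaLieAlgebra br ω) (hω : ω.IsAlt)
    (h2 : (2 : K) ≠ 0) (hn : 4 ≤ Module.rank K L) (hR : HasRankLETwo ω) {u v : L}
    (huv : ω u v ≠ 0) : ∃ l, IsKerTrace br ω l := by
  set l := (ω u v)⁻¹ • coboundary br ω u v with hl
  have bracket z (hz : ω z = 0) t (ht : ω t = 0) : br z t = l z • t - l t • z := by
    rw [← inv_smul_smul₀ huv (br z t), hL.omega_smul_bracket_ker hω h2 hz ht]
    simp [hl, mul_smul, smul_sub]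
  refine ⟨l, bracket, fun z hz x y => ?_⟩
  by_cases hz0 : z = 0
  · simp [hz0]
  obtain ⟨φ, hφ⟩ := Module.Projective.exists_dual_eq_one K hz0
  obtain ⟨t, ht0, ht'⟩ := exists_ne_zero_forall_apply_eq_zero ![ω.flip u, ω.flip v, φ]
    (lt_of_lt_of_le (by norm_num) hn)
  have ht : ω t = 0 := hR u v t huv (ht' 0) (ht' 1)
  have hφt : φ t = 0 := ht' 2
  have e := hL.omega_smul_bracket_ker hω h2 hz ht x y
  rw [bracket z hz t ht] at e
  have hδt : ω x y * l t = coboundary br ω x y t := by simpa [hφ, hφt] using congrArg φ e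
  have hδz : coboundary br ω x y z = l z * ω x y := by
    refine smul_left_injective K ht0 ?_
    simp only
    rw [← hδt] at e
    linear_combination (norm := module) -e
  rw [← hδz, coboundary_apply, hω.isRefl.eq_zero (LinearMap.congr_fun hz _),
    hL.bracket_swap y z, ← hω.neg (br z y) x, map_neg, LinearMap.neg_apply, zero_add]

/-! ### Infinitesimal similitudes of a form of rank two -/

namespace HasMultiplier

variable {f g : Module.End K L} {c : K} {u : L}

lemma omega_comm (hf : HasMultiplier ω f 0) (hω : ω.IsAlt) (x y : L) :
    ω (f x) y = ω (f y) x := by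
  linear_combination hf x y + hω.neg x (f y)

lemma omega_apply_self (hf : HasMultiplier ω f 0) (hω : ω.IsAlt) (x : L) :
    ω (f (f x)) x = 0 := by
  rw [hf.omega_comm hω, hω.self_eq_zero]

lemma exists_omega_ne_zero (hf : HasMultiplier ω f 0) (hω : ω.IsAlt) (h2 : (2 : K) ≠ 0) {w : L}
    (hw : ω (f w) ≠ 0) : ∃ u, ω (f u) u ≠ 0 := by
  by_contra! h
  refine hw (LinearMap.ext fun y => ?_)
  have e := h (w + y)
  simp only [map_add, LinearMap.add_apply, h, hf.omega_comm hω y w, add_zero, zero_add] at e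
  exact (mul_eq_zero.mp ((two_mul _).trans e)).resolve_left h2

/-- On the plane `L ⧸ ker ω` only the multiples of `f` commute with `f`, and `u` detects them. -/
lemma omega_apply_eq_zero_of_commute (hf : HasMultiplier ω f 0) (hg : HasMultiplier ω g 0)
    (hω : ω.IsAlt) (h2 : (2 : K) ≠ 0) (hR : HasRankLETwo ω)
    (hfg : ∀ w, ω (g (f w)) = ω (f (g w))) (hu : ω (f u) u ≠ 0) (hgu : ω (g u) u = 0) (w : L) :
    ω (g w) = 0 := by
  have hgu_fu : ω (g u) (f u) = 0 := by
    have e : ω (g u) (f u) = -ω (g u) (f u) := by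
      rw [hω.neg, hg.omega_comm hω, hfg, hf.omega_comm hω]
    exact (mul_eq_zero.mp (by linear_combination e)).resolve_left h2
  have hgu_zero : ω (g u) = 0 := hR (f u) u _ hu hgu_fu hgu
  refine hR (f u) u _ hu ?_ ?_
  · rw [hg.omega_comm hω, hfg, hf.omega_comm hω]
    exact hω.isRefl.eq_zero (LinearMap.congr_fun hgu_zero _)
  · rw [hg.omega_comm hω, hgu_zero, LinearMap.zero_apply]

/-- On the plane `L ⧸ ker ω`, an operator `f` of nonzero weight `c` under `g` is nilpotent and
its image is an eigenline of `g`. -/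
lemma eigenvector_of_commutator_eq_smul (hf : HasMultiplier ω f 0) (hg : HasMultiplier ω g c)
    (hω : ω.IsAlt) (h2 : (2 : K) ≠ 0) (hR : HasRankLETwo ω) (hc : c ≠ 0)
    (hgf : ∀ w, ω (g (f w)) = ω (f (g w)) + c • ω (f w)) (hu : ω (f u) u ≠ 0) :
    ω (f (f u)) = 0 ∧ ω (g (f u)) = c • ω (f u) := by
  have hfw_gw w : ω (f w) (g w) = 0 := by
    have e := LinearMap.congr_fun (hgf w) w
    simp only [LinearMap.add_apply, LinearMap.smul_apply, smul_eq_mul,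
      hf.omega_comm hω (g w)] at e
    exact (mul_eq_zero.mp (by linear_combination hg (f w) w - e)).resolve_left h2
  have hgfu_u : ω (g (f u)) u = c * ω (f u) u := by
    linear_combination hg (f u) u - hfw_gw u
  have hffu : ω (f (f u)) = 0 := by
    refine hR (g (f u)) u _ ?_ (hfw_gw (f u)) (hf.omega_apply_self hω u)
    rw [hgfu_u]
    exact mul_ne_zero hc hu
  refine ⟨hffu, ?_⟩
  rw [← sub_eq_zero, ← map_smul, ← map_sub]
  refine hR (f u) u _ hu ?_ (by simp [hgfu_u])
  simp [hgf u, hf.omega_comm hω (g u), hffu]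

end HasMultiplier

/-! ### Unimodular action of the kernel -/

namespace IsKerTrace

variable {l : Module.Dual K L} {r u z : L}

lemma isAbelian (hl : IsKerTrace br ω l) :
    IsAbelian br (LinearMap.ker ω ⊓ LinearMap.ker l) := by
  rintro a ⟨ha, hla : l a = 0⟩ b ⟨hb, hlb : l b = 0⟩
  simp [hl.bracket a ha b hb, hla, hlb]

lemma hasMultiplier_zero (hl : IsKerTrace br ω l) (hz : ω z = 0) (hlz : l z = 0) :
    HasMultiplier ω (br z) 0 :=
  hlz ▸ hl.hasMultiplier z hz

lemma bracket_bracket_comm (hl : IsKerTrace br ω l) (hL : IsOmegaLieAlgebra br ω) (hω : ω.IsAlt)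
    (hr : ω r = 0) (hlr : l r = 0) (hz : ω z = 0) (hlz : l z = 0) (w : L) :
    br z (br r w) = br r (br z w) := by
  have e := hL.jacobi_ker hω hz hr w
  simp only [hl.bracket z hz r hr, hlr, hlz, zero_smul, sub_zero, map_zero,
    LinearMap.zero_apply] at e
  exact sub_eq_zero.mp e.symm

lemma omega_bracket_eq_zero (hl : IsKerTrace br ω l) (hL : IsOmegaLieAlgebra br ω)
    (hω : ω.IsAlt) (h2 : (2 : K) ≠ 0) (hR : HasRankLETwo ω) (hr : ω r = 0) (hlr : l r = 0)
    (hu : ω (br r u) u ≠ 0) (hz : ω z = 0) (hlz : l z = 0) (hzu : ω (br z u) u = 0) (w : L) :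
    ω (br z w) = 0 :=
  (hl.hasMultiplier_zero hr hlr).omega_apply_eq_zero_of_commute (hl.hasMultiplier_zero hz hlz)
    hω h2 hR (fun w => by rw [hl.bracket_bracket_comm hL hω hr hlr hz hlz]) hu hzu w

lemma omega_bracket_bracket_eq_zero (hl : IsKerTrace br ω l) (hL : IsOmegaLieAlgebra br ω)
    (hω : ω.IsAlt) (h2 : (2 : K) ≠ 0) (hR : HasRankLETwo ω) (hr : ω r = 0) (hlr : l r = 0)
    (hu : ω (br r u) u ≠ 0) (hrru : ω (br r (br r u)) = 0) (hz : ω z = 0) (hlz : l z = 0) :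
    ω (br z (br r u)) = 0 := by
  have h := hl.omega_bracket_eq_zero hL hω h2 hR hr hlr hu
    (z := ω (br r u) u • z - ω (br z u) u • r) (by simp [hr, hz]) (by simp [hlr, hlz])
    (by simp [mul_comm]) (br r u)
  simpa [hrru, hu] using h

/-- Otherwise some `z ≠ 0` in `ker ω` with `ω [z, u] u = 0` annihilates `ker ω`, `[r, u]` and
`[r, [r, u]]`, hence all of `L`. -/
lemma omega_bracket_bracket_self_eq_zero (hl : IsKerTrace br ω l) (hL : IsOmegaLieAlgebra br ω)
    (hω : ω.IsAlt) (h2 : (2 : K) ≠ 0) (hn : 4 ≤ Module.rank K L) (hR : HasRankLETwo ω)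
    (hl0 : ∀ z, ω z = 0 → l z = 0) (hr : ω r = 0) (hu : ω (br r u) u ≠ 0) :
    ω (br r (br r u)) = 0 := by
  have hr_skew := hl.hasMultiplier_zero hr (hl0 r hr)
  refine hR (br r u) u _ hu ?_ (hr_skew.omega_apply_self hω u)
  by_contra hne
  obtain ⟨z, hz0, hz'⟩ := exists_ne_zero_forall_apply_eq_zero
    ![ω.flip (br r u), ω.flip u, ω.flip u ∘ₗ br.flip u] (lt_of_lt_of_le (by norm_num) hn)
  have hz : ω z = 0 := hR (br r u) u z hu (hz' 0) (hz' 1)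
  have hzker w (hw : ω w = 0) : br z w = 0 := by simp [hl.bracket z hz w hw, hl0 z hz, hl0 w hw]
  have hzr w : br z (br r w) = 0 := by
    have hzw : ω (br z w) = 0 := hl.omega_bracket_eq_zero hL hω h2 hR hr (hl0 r hr) hu hz
      (hl0 z hz) (hz' 2) w
    rw [hl.bracket_bracket_comm hL hω hr (hl0 r hr) hz (hl0 z hz), hl.bracket r hr _ hzw,
      hl0 r hr, hl0 _ hzw, zero_smul, zero_smul, sub_zero]
  have hbr : br z = 0 := hR.eq_zero_of_apply_eq_zero hω hne hzker (hzr _) (hzr u)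
  exact hz0 (hL.eq_zero_of_central hω (fun h => hu (by simp [h])) hz fun w => by simp [hbr])

lemma exists_omega_bracket_eq_zero (hl : IsKerTrace br ω l) (hL : IsOmegaLieAlgebra br ω)
    (hω : ω.IsAlt) (hω0 : ω ≠ 0) (h2 : (2 : K) ≠ 0) (hn : 4 ≤ Module.rank K L)
    (hR : HasRankLETwo ω) (hl0 : ∀ z, ω z = 0 → l z = 0) :
    ∃ y, ω y ≠ 0 ∧ ∀ z, ω z = 0 → ω (br z y) = 0 := by
  by_cases! h : ∀ r, ω r = 0 → ∀ w, ω (br r w) = 0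
  · obtain ⟨y, hy⟩ : ∃ y, ω y ≠ 0 := DFunLike.exists_ne hω0
    exact ⟨y, hy, fun z hz => h z hz y⟩
  obtain ⟨r, hr, w, hw⟩ := h
  obtain ⟨u, hu⟩ := (hl.hasMultiplier_zero hr (hl0 r hr)).exists_omega_ne_zero hω h2 hw
  refine ⟨br r u, fun h => hu (by simp [h]), fun z hz => ?_⟩
  exact hl.omega_bracket_bracket_eq_zero hL hω h2 hR hr (hl0 r hr) hu
    (hl.omega_bracket_bracket_self_eq_zero hL hω h2 hn hR hl0 hr hu) hz (hl0 z hz)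

lemma typeA (hl : IsKerTrace br ω l) (hω : ω.IsAlt) (hR : HasRankLETwo ω)
    (hl0 : ∀ z, ω z = 0 → l z = 0) {y : L} (hy : ω y ≠ 0) (hyker : ∀ z, ω z = 0 → ω (br z y) = 0) :
    TypeA br (LinearMap.ker (ω.flip y)) (LinearMap.ker ω) := by
  refine ⟨LinearMap.ker ω, y, hy, (hR.ker_sup_span_singleton hω hy).symm, ?_, hyker, rfl⟩
  intro z hz t ht
  simp [hl.bracket z hz t ht, hl0 z hz, hl0 t ht]

end IsKerTrace

/-! ### Non-unimodular action of the kernel -/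

namespace IsKerTrace

variable {l : Module.Dual K L} {a r u v x : L}

lemma bracket_of_trace_eq_neg_one (hl : IsKerTrace br ω l) (hx : ω x = 0) (hlx : l x = -1)
    (ha : ω a = 0) (hla : l a = 0) : br a x = a := by
  simp [hl.bracket a ha x hx, hlx, hla]

lemma omega_bracket_bracket_of_trace_eq_neg_one (hl : IsKerTrace br ω l)
    (hL : IsOmegaLieAlgebra br ω) (hω : ω.IsAlt) (h2 : (2 : K) ≠ 0) (hR : HasRankLETwo ω)
    (hx : ω x = 0) (hlx : l x = -1) (hr : ω r = 0) (hlr : l r = 0) (hu : ω (br r u) u ≠ 0) :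
    ω (br r (br r u)) = 0 ∧ ω (br x (br r u)) = -ω (br r u) := by
  have hcomm w : ω (br x (br r w)) = ω (br r (br x w)) + (-1 : K) • ω (br r w) := by
    have e := hL.jacobi_ker hω hr hx w
    rw [hl.bracket_of_trace_eq_neg_one hx hlx hr hlr] at e
    rw [← map_smul, ← map_add]
    congr 1
    linear_combination (norm := module) e
  rw [← neg_one_smul K (ω (br r u))]
  exact (hl.hasMultiplier_zero hr hlr).eigenvector_of_commutator_eq_smul
    (hlx ▸ hl.hasMultiplier x hx) hω h2 hR (neg_ne_zero.mpr one_ne_zero) hcomm hu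

/-- Replacing `v` by `y = v + l([x, v] + v) x` makes `ad y` vanish on the abelian part. -/
lemma bracket_add_smul_eq_zero (hl : IsKerTrace br ω l) (hL : IsOmegaLieAlgebra br ω)
    (hω : ω.IsAlt) (h2 : (2 : K) ≠ 0) (hx : ω x = 0) (hlx : l x = -1) (ha : ω a = 0) (hla : l a = 0)
    (hxv : ω (br x v + v) = 0) (hav : ω (br a v) = 0) :
    br a (v + l (br x v + v) • x) = 0 := by
  have e := hL.jacobi_ker hω ha hx v
  have e' := hl.bracket a ha _ hxv
  rw [hl.bracket_of_trace_eq_neg_one hx hlx ha hla, hl.bracket x hx _ hav, hlx] at e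
  rw [map_add, hla] at e'
  have hm : br a v = l (br a v) • x - l (br x v + v) • a := by
    linear_combination (norm := module) e + e'
  have hlm : l (br a v) = 0 := by
    have h := congrArg l hm
    simp only [map_sub, map_smul, smul_eq_mul, hlx, hla] at h
    exact (mul_eq_zero.mp (by linear_combination h)).resolve_left h2
  rw [hlm] at hm
  rw [map_add, map_smul, hl.bracket_of_trace_eq_neg_one hx hlx ha hla, hm]
  module

lemma exists_bracket_eq_zero_of_trace_eq_neg_one (hl : IsKerTrace br ω l)
    (hL : IsOmegaLieAlgebra br ω) (hω : ω.IsAlt) (h2 : (2 : K) ≠ 0) (hR : HasRankLETwo ω)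
    (hx : ω x = 0) (hlx : l x = -1) (hr : ω r = 0) (hlr : l r = 0) (hu : ω (br r u) u ≠ 0) :
    ∃ y, ω y ≠ 0 ∧ (∀ a, ω a = 0 → l a = 0 → br a y = 0) ∧
      br x y + y ∈ LinearMap.ker ω ⊓ LinearMap.ker l := by
  obtain ⟨hrv, hxv⟩ :=
    hl.omega_bracket_bracket_of_trace_eq_neg_one hL hω h2 hR hx hlx hr hlr hu
  set v := br r u
  have hn : ω (br x v + v) = 0 := by rw [map_add, hxv, neg_add_cancel]
  set n := br x v + v with hn_def
  refine ⟨v + l n • x, fun h => hu (by simpa [hx] using LinearMap.congr_fun h u),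
    fun a ha hla => ?_, ?_⟩
  · exact hl.bracket_add_smul_eq_zero hL hω h2 hx hlx ha hla hn
      (hl.omega_bracket_bracket_eq_zero hL hω h2 hR hr hlr hu hrv ha hla)
  · have e : br x (v + l n • x) + (v + l n • x) = n + l n • x := by
      rw [map_add, map_smul, hL.bracket_self, hn_def]
      module
    rw [e]
    exact ⟨by simp [hn, hx], by simp [hlx]⟩

lemma typeD (hl : IsKerTrace br ω l) (hω : ω.IsAlt) (hR : HasRankLETwo ω) (hx : ω x = 0)
    (hlx : l x = -1) {y : L} (hy : ω y ≠ 0) (hay : ∀ a, ω a = 0 → l a = 0 → br a y = 0)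
    (hxy : br x y + y ∈ LinearMap.ker ω ⊓ LinearMap.ker l) :
    TypeD br (LinearMap.ker (ω.flip y)) (LinearMap.ker ω) := by
  have hker : LinearMap.ker ω = LinearMap.ker ω ⊓ LinearMap.ker l ⊔ Submodule.span K {x} :=
    (inf_ker_sup_span_singleton hx (by simp [hlx])).symm
  refine ⟨LinearMap.ker ω ⊓ LinearMap.ker l, x, y, fun h => ?_, hker ▸ hy, ?_, hl.isAbelian,
    fun a ha => hl.bracket_of_trace_eq_neg_one hx hlx ha.1 ha.2, fun a ha => hay a ha.1 ha.2,
    ⟨_, hxy, -1, neg_ne_zero.mpr one_ne_zero, by module⟩, hker⟩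
  · exact one_ne_zero (neg_eq_zero.mp (hlx.symm.trans h.2))
  · rw [← hker, hR.ker_sup_span_singleton hω hy]

lemma omega_bracket_self_eq_zero (hω : ω.IsAlt) (hx : ω x = 0) (hlx : l x = -1) {y z : L}
    (hay : ∀ a, ω a = 0 → l a = 0 → br a y = 0) (hxy : ω (br x y + y) = 0) (hz : ω z = 0) :
    ω (br z y) y = 0 := by
  have h := LinearMap.congr_fun (congrArg ω
    (hay (z + l z • x) (by simp [hz, hx]) (by simp [hlx]))) y
  have hxy' := LinearMap.congr_fun hxy y
  simp only [map_add, map_smul, LinearMap.add_apply, LinearMap.smul_apply, smul_eq_mul,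
    map_zero, LinearMap.zero_apply, hω.self_eq_zero, add_zero] at h hxy'
  linear_combination h - l z * hxy'

lemma isAlmostAbelianWithPart (hl : IsKerTrace br ω l) (hL : IsOmegaLieAlgebra br ω)
    (hω : ω.IsAlt) (h2 : (2 : K) ≠ 0) (hx : ω x = 0) (hlx : l x = -1) :
    IsAlmostAbelianWithPart br (LinearMap.ker ω) (LinearMap.ker ω ⊓ LinearMap.ker l) := by
  refine ⟨hL.isLieSubalgebra (hL.isSubalgebra_ker hω h2) fun z hz t _ => LinearMap.congr_fun hz t,
    hl.isAbelian, x, fun h => ?_, (inf_ker_sup_span_singleton hx (by simp [hlx])).symm,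
    fun a ha => hl.bracket_of_trace_eq_neg_one hx hlx ha.1 ha.2⟩
  exact one_ne_zero (neg_eq_zero.mp (hlx.symm.trans h.2))

lemma isNilpotent_ad (hl : IsKerTrace br ω l) (hL : IsOmegaLieAlgebra br ω) (ha : ω a = 0)
    (hla : l a = 0) (htriv : ∀ w, ω (br a w) = 0) : IsNilpotent (ad br a) := by
  refine ⟨3, LinearMap.ext fun w => ?_⟩
  have hwa : ω (br w a) = 0 := by rw [hL.bracket_swap, map_neg, htriv, neg_zero]
  have hwaa : br (br w a) a = l (br w a) • a := by simp [hl.bracket _ hwa a ha, hla]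
  simp [pow_succ, ad, hwaa, hL.bracket_self]

end IsKerTrace

/-! ### The classification -/

lemma finrank_add_one_eq_of_covBy [FiniteDimensional K L] {S T : Submodule K L} (h : S ⋖ T) :
    Module.finrank K S + 1 = Module.finrank K T := by
  obtain ⟨y, hyT, hyS⟩ := SetLike.exists_of_lt h.lt
  have hspan : Submodule.span K {y} ⊔ S = T := by
    refine (h.eq_or_eq le_sup_right ?_).resolve_left fun e => hyS ?_
    · exact sup_le ((Submodule.span_singleton_le_iff_mem y T).mpr hyT) h.le
    · exact e ▸ Submodule.mem_sup_left (Submodule.mem_span_singleton_self y)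
  rw [← hspan, sup_comm, Submodule.finrank_sup_span_singleton hyS]

lemma finrank_add_eq_of_rank_quotient_eq [FiniteDimensional K L] {S : Submodule K L} {n : ℕ}
    (h : Module.rank K (L ⧸ S) = n) : Module.finrank K S + n = Module.finrank K L := by
  rw [← Module.finrank_eq_of_rank_eq h, add_comm, S.finrank_quotient_add_finrank]

lemma finrank_le_add_of_rank_quotient_le [FiniteDimensional K L] {S : Submodule K L} {n : ℕ}
    (h : Module.rank K (L ⧸ S) ≤ n) : Module.finrank K L ≤ Module.finrank K S + n := by
  rw [← S.finrank_quotient_add_finrank, add_comm]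
  exact Nat.add_le_add_left (Module.finrank_le_of_rank_le h) _

/-- `M` is a Lie subalgebra of codimension `1` which is of type (a) or (d) with respect to the
linear form `x ↦ ω x v`, for every `v ∉ M`. Codimension `1` is expressed in the lattice of
subspaces, so that the notion makes sense in infinite dimension. -/
structure IsListedHyperplane (br : L →ₗ[K] L →ₗ[K] L) (ω : L →ₗ[K] L →ₗ[K] K)
    (M : Submodule K L) : Prop where
  isLieSubalgebra : IsLieSubalgebra br M
  isCoatom : IsCoatom M
  isSubalgebra_alphaKer : ∀ v ∉ M, IsSubalgebra br (alphaKer ω M v)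
  alphaKer_covBy : ∀ v ∉ M, alphaKer ω M v ⋖ M
  typeA_or_typeD : ∀ v ∉ M, TypeA br M (alphaKer ω M v) ∨ TypeD br M (alphaKer ω M v)

lemma IsListedHyperplane.isListed [FiniteDimensional K L] {M : Submodule K L}
    (h : IsListedHyperplane br ω M) {v : L} (hv : v ∉ M) : IsListed br M (alphaKer ω M v) :=
  ⟨h.isSubalgebra_alphaKer v hv, finrank_add_one_eq_of_covBy (h.alphaKer_covBy v hv),
    (h.typeA_or_typeD v hv).imp_right fun hd => .inr (.inr hd)⟩

lemma IsOmegaLieAlgebra.isListedHyperplane_ker_flip (hL : IsOmegaLieAlgebra br ω) (hω : ω.IsAlt)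
    (h2 : (2 : K) ≠ 0) (hR : HasRankLETwo ω) {y : L} (hy : ω y ≠ 0)
    (hclosed : ∀ z, ω z = 0 → ω (br z y) y = 0)
    (htype : TypeA br (LinearMap.ker (ω.flip y)) (LinearMap.ker ω) ∨
      TypeD br (LinearMap.ker (ω.flip y)) (LinearMap.ker ω)) :
    IsListedHyperplane br ω (LinearMap.ker (ω.flip y)) := by
  have hsup := hR.ker_sup_span_singleton hω hy
  have hker := hL.isSubalgebra_ker hω h2
  have hsub : IsSubalgebra br (LinearMap.ker (ω.flip y)) := by
    rw [← hsup]
    exact hL.isSubalgebra_sup_span_singleton hker fun z hz => hsup ▸ hclosed z hz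
  have hiso : ∀ p ∈ LinearMap.ker (ω.flip y), ∀ q ∈ LinearMap.ker (ω.flip y), ω p q = 0 := by
    intro p hp q hq
    by_contra h
    exact hy (hR p q y h (hω.isRefl.eq_zero hp) (hω.isRefl.eq_zero hq))
  refine ⟨hL.isLieSubalgebra hsub hiso, isCoatom_ker_flip hω hy, fun v hv => ?_, fun v hv => ?_,
    fun v hv => ?_⟩ <;> rw [hR.alphaKer_eq_ker hv]
  · exact hker
  · rw [← hsup, sup_comm]
    exact Submodule.covBy_span_singleton_sup hy
  · exact htype

lemma IsKerTrace.isListedHyperplane_or_isAlmostAbelianWithPart {l : Module.Dual K L}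
    (hl : IsKerTrace br ω l) (hL : IsOmegaLieAlgebra br ω) (hω : ω.IsAlt) (h2 : (2 : K) ≠ 0)
    (hn : 4 ≤ Module.rank K L) (hR : HasRankLETwo ω) (hω0 : ω ≠ 0) :
    (∃ M, IsListedHyperplane br ω M) ∨
    ∃ A, IsAlmostAbelianWithPart br (LinearMap.ker ω) A ∧ ∀ a ∈ A, IsNilpotent (ad br a) := by
  by_cases! hl0 : ∀ z, ω z = 0 → l z = 0
  · obtain ⟨y, hy, hyker⟩ := hl.exists_omega_bracket_eq_zero hL hω hω0 h2 hn hR hl0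
    exact .inl ⟨_, hL.isListedHyperplane_ker_flip hω h2 hR hy
      (fun z hz => LinearMap.congr_fun (hyker z hz) y) (.inl (hl.typeA hω hR hl0 hy hyker))⟩
  obtain ⟨x, hx, hlx⟩ : ∃ x, ω x = 0 ∧ l x = -1 := by
    obtain ⟨z, hz, hlz⟩ := hl0
    exact ⟨-(l z)⁻¹ • z, by simp [hz], by simp [hlz]⟩
  by_cases! htriv : ∀ a, ω a = 0 → l a = 0 → ∀ w, ω (br a w) = 0
  · exact .inr ⟨_, hl.isAlmostAbelianWithPart hL hω h2 hx hlx,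
      fun a ha => hl.isNilpotent_ad hL ha.1 ha.2 (htriv a ha.1 ha.2)⟩
  · obtain ⟨r, hr, hlr, w, hw⟩ := htriv
    obtain ⟨u, hu⟩ := (hl.hasMultiplier_zero hr hlr).exists_omega_ne_zero hω h2 hw
    obtain ⟨y, hy, hay, hxy⟩ :=
      hl.exists_bracket_eq_zero_of_trace_eq_neg_one hL hω h2 hR hx hlx hr hlr hu
    exact .inl ⟨_, hL.isListedHyperplane_ker_flip hω h2 hR hy
      (fun z hz => omega_bracket_self_eq_zero hω hx hlx hay hxy.1 hz)
      (.inr (hl.typeD hω hR hx hlx hy hay hxy))⟩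

end OmegaLie

open OmegaLie in
theorem theorem9p1_general {K L : Type*} [Field K] (h2 : (2 : K) ≠ 0)
    [AddCommGroup L] [Module K L] (h5 : (3 : K) = 0 → Module.rank K L ≠ 5)
    (br : L →ₗ[K] L →ₗ[K] L) (ω : L →ₗ[K] L →ₗ[K] K)
    (hL : IsOmegaLieAlgebra br ω) (hnotLie : ¬IsLieAlgebra br) :
    (Module.rank K L = 3 ∨
      (∃ M, IsListedHyperplane br ω M) ∨
      (Module.rank K (L ⧸ LinearMap.ker ω) = 2 ∧
        ∃ A, IsAlmostAbelianWithPart br (LinearMap.ker ω) A ∧ ∀ a ∈ A, IsNilpotent (ad br a))) ∧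
    ∃ B, IsAbelian br B ∧ Module.rank K (L ⧸ B) ≤ 3 := by
  have hrank := hL.three_le_rank hnotLie
  have hω := hL.omega_isAlt (le_trans (by norm_num) hrank)
  have hω0 := hL.omega_ne_zero hnotLie
  obtain hrank | hrank := hrank.eq_or_lt
  · exact ⟨.inl hrank.symm, ⊥, by simp [IsAbelian],
      ((Submodule.quotEquivOfEqBot _ rfl).rank_eq.trans hrank.symm).le⟩
  have hn : 4 ≤ Module.rank K L := by exact_mod_cast Order.succ_le_of_lt hrank
  have hR := hL.hasRankLETwo hω h2 hn h5
  obtain ⟨u, hu⟩ : ∃ u, ω u ≠ 0 := DFunLike.exists_ne hω0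
  obtain ⟨v, huv⟩ : ∃ v, ω u v ≠ 0 := DFunLike.exists_ne hu
  obtain ⟨l, hl⟩ := hL.exists_isKerTrace hω h2 hn hR huv
  exact ⟨.inr ((hl.isListedHyperplane_or_isAlmostAbelianWithPart hL hω h2 hn hR hω0).imp_right
    fun h => ⟨hR.rank_quotient_ker hω huv, h⟩), _, hl.isAbelian, hR.rank_quotient_ker_inf_ker huv l⟩

theorem theorem9p1 {K L : Type*} [Field K] (h2 : ringChar K ≠ 2) (h3 : ringChar K ≠ 3)
    [AddCommGroup L] [Module K L] [FiniteDimensional K L]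
    (br : L →ₗ[K] L →ₗ[K] L) (ω : L →ₗ[K] L →ₗ[K] K)
    (hL : OmegaLie.IsOmegaLieAlgebra br ω) (hnotLie : ¬ OmegaLie.IsLieAlgebra br) :
    (Module.finrank K L = 3 ∨
      (∃ M : Submodule K L, OmegaLie.IsLieSubalgebra br M ∧
        Module.finrank K M + 1 = Module.finrank K L ∧
        ∀ v : L, v ∉ M → OmegaLie.IsListed br M (OmegaLie.alphaKer ω M v)) ∨
      (Module.finrank K (LinearMap.ker ω) + 2 = Module.finrank K L ∧
        ∃ A : Submodule K L, OmegaLie.IsAlmostAbelianWithPart br (LinearMap.ker ω) A ∧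
          ∀ a ∈ A, IsNilpotent (OmegaLie.ad br a))) ∧
    (∃ B : Submodule K L, OmegaLie.IsAbelian br B ∧
      Module.finrank K L ≤ Module.finrank K B + 3) := by
  obtain ⟨h, B, hB, hBrank⟩ := theorem9p1_general (Ring.two_ne_zero h2)
    (fun h => absurd (CharP.ringChar_of_prime_eq_zero Nat.prime_three (mod_cast h)) h3)
    br ω hL hnotLie
  refine ⟨h.imp Module.finrank_eq_of_rank_eq (.imp ?_ ?_), B, hB,
    OmegaLie.finrank_le_add_of_rank_quotient_le hBrank⟩
  · rintro ⟨M, hM⟩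
    exact ⟨M, hM.isLieSubalgebra, finrank_top K L ▸
      OmegaLie.finrank_add_one_eq_of_covBy hM.isCoatom.covBy_top, fun _ => hM.isListed⟩
  · exact .imp_left OmegaLie.finrank_add_eq_of_rank_quotient_eq
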